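/- Let $G$ be a (Hausdorff) locally compact group with left Haar measure $ds$, let $L^r(G)$ be the complex Lebesgue spaces with respect to $ds$, and let $C_c(G)$ be the space of continuous compactly supported functions $G\to\mathbb C$ with convolution $(f*g)(t)=\int_G f(s)\,g(s^{-1}t)\,ds$. We say that convolution extends to a bounded bilinear map $L^r(G)\times L^s(G)\to L^s(G)$ if there is a bounded bilinear map $B:L^r(G)\times L^s(G)\to L^s(G)$ with $B(f,g)=f*g$ for all $f,g\in C_c(G)$. Assume that $G$ is a Kunze–Stein group, i.e. that convolution extends to a bounded bilinear map $L^r(G)\times L^2(G)\to L^2(G)$ for every $1\le r<2$. Let $1<q\le 2$ and let $p$ be the conjugate exponent of $q$, $\frac1p+\frac1q=1$. Let $\lambda_p(f)g=f*g$ for $f\in L^1(G)$ and $g\in L^p(G)$, similarly $\lambda_q$, and let $PF_p^*(G)$ be the completion of $L^1(G)$ with respect to the norm $$\|f\|_{PF_p^*(G)}=\max\{\|\lambda_p(f)\|_{B(L^p(G))},\ \|\lambda_q(f)\|_{B(L^q(G))}\}.$$ Then for every $1\le q'<q$, convolution extends to bounded bilinear maps $$L^{q'}(G)\times L^q(G)\to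 L^q(G)\qquad\text{and}\qquad L^{q'}(G)\times L^p(G)\to L^p(G),$$ and consequently the identity map on $C_c(G)$ extends to a bounded linear map $L^{q'}(G)\to PF_p^*(G)$. -/

import Mathlib

open MeasureTheory Measure Filter Topology
open scoped ENNReal CompactlySupported Pointwise

set_option linter.unusedSectionVars false

noncomputable section

namespace KunzeStein

variable {G : Type*} [Group G] [TopologicalSpace G] [IsTopologicalGroup G]
  [LocallyCompactSpace G] [T2Space G] [MeasurableSpace G] [BorelSpace G]

/-- The convolution product `(f * g)(x) = ∫ f(y) g(y⁻¹ x) dμ(y)` of complex functions on a group;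
here `μ` will be a left Haar measure. -/
def conv (μ : Measure G) (f g : G → ℂ) (x : G) : ℂ := ∫ y, f y * g (y⁻¹ * x) ∂μ

theorem conv_support_subset (μ : Measure G) (f g : C_c(G, ℂ)) (x : G)
    (hx : x ∉ tsupport f * tsupport g) : conv μ f g x = 0 := by
  have h : ∀ y, f y * g (y⁻¹ * x) = 0 := by
    intro y
    by_contra hne
    apply hx
    have h1 : f y ≠ 0 := fun h0 => hne (by simp [h0])
    have h2 : g (y⁻¹ * x) ≠ 0 := fun h0 => hne (by simp [h0])
    exact Set.mem_mul.2 ⟨y, subset_tsupport _ h1, y⁻¹ * x, subset_tsupport _ h2, mul_inv_cancel_left y x⟩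
  simp [conv, h]

theorem continuous_conv (μ : Measure G) [IsFiniteMeasureOnCompacts μ] (f g : C_c(G, ℂ)) :
    Continuous (conv μ f g) := by
  have hf : IsCompact (tsupport f) := f.hasCompactSupport
  rw [← continuousOn_univ]
  refine continuousOn_integral_of_compact_support (k := tsupport f) hf ?_ ?_
  · exact ((f.continuous.comp continuous_snd).mul
      (g.continuous.comp (continuous_snd.inv.mul continuous_fst))).continuousOn
  · intro x y _ hy
    rw [image_eq_zero_of_notMem_tsupport hy, zero_mul]

/-- The convolution product `m : C_c(G) × C_c(G) → C_c(G)`. -/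
def convCc (μ : Measure G) [IsFiniteMeasureOnCompacts μ] (f g : C_c(G, ℂ)) : C_c(G, ℂ) where
  toFun := conv μ f g
  continuous_toFun := continuous_conv μ f g
  hasCompactSupport' :=
    HasCompactSupport.intro (f.hasCompactSupport.isCompact.mul g.hasCompactSupport.isCompact)
      (fun x hx => conv_support_subset μ f g x hx)

/-- The class in `L^r(G)` of a continuous compactly supported function. -/
def ccToLp (μ : Measure G) [IsFiniteMeasureOnCompacts μ] (r : ℝ≥0∞) (f : C_c(G, ℂ)) :
    Lp ℂ r μ :=
  (f.continuous.memLp_of_hasCompactSupport (μ := μ) (p := r) f.hasCompactSupport).toLp f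

/-- The convolution product on `C_c(G)` extends to a bounded bilinear map
`L^r(G) × L^s(G) → L^s(G)`. -/
def ConvExtends (μ : Measure G) [IsFiniteMeasureOnCompacts μ] (r s : ℝ≥0∞)
    [Fact (1 ≤ r)] [Fact (1 ≤ s)] : Prop :=
  ∃ B : Lp ℂ r μ →L[ℂ] Lp ℂ s μ →L[ℂ] Lp ℂ s μ,
    ∀ f g : C_c(G, ℂ), B (ccToLp μ r f) (ccToLp μ s g) = ccToLp μ s (convCc μ f g)

/-- The Kunze-Stein phenomenon: convolution extends to a bounded bilinear map
`L^r(G) × L^2(G) → L^2(G)` for every `1 ≤ r < 2`. -/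
def IsKunzeStein (μ : Measure G) [IsFiniteMeasureOnCompacts μ] : Prop :=
  ∀ (r : ℝ≥0∞) [Fact (1 ≤ r)], r < 2 → ConvExtends μ r 2

section Regular

variable (μ : Measure G) [μ.IsHaarMeasure] [μ.Regular]

/-- Left translation `(L_s g)(x) = g(s⁻¹ x)` on `L^p(G)`. -/
def leftTranslate (p : ℝ≥0∞) (s : G) (g : Lp ℂ p μ) : Lp ℂ p μ := DomMulAct.mk s⁻¹ • g

theorem leftTranslate_ae (p : ℝ≥0∞) (s : G) (g : Lp ℂ p μ) :
    leftTranslate μ p s g =ᵐ[μ] fun x => g (s⁻¹ * x) :=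
  DomMulAct.smul_Lp_ae_eq (DomMulAct.mk s⁻¹) g

theorem norm_leftTranslate (p : ℝ≥0∞) (s : G) (g : Lp ℂ p μ) :
    ‖leftTranslate μ p s g‖ = ‖g‖ := DomMulAct.norm_smul_Lp _ _

theorem continuous_leftTranslate (p : ℝ≥0∞) [Fact (1 ≤ p)] [Fact (p ≠ ∞)] (g : Lp ℂ p μ) :
    Continuous fun s : G => leftTranslate μ p s g :=
  ((DomMulAct.continuous_mk).comp continuous_inv).smul continuous_const

theorem integrable_smul_leftTranslate (p : ℝ≥0∞) [Fact (1 ≤ p)] [Fact (p ≠ ∞)]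
    (f : Lp ℂ 1 μ) (g : Lp ℂ p μ) : Integrable (fun s => f s • leftTranslate μ p s g) μ := by
  have hmeas : AEStronglyMeasurable (fun s => f s • leftTranslate μ p s g) μ := by
    refine Lp.induction ENNReal.one_ne_top
      (motive := fun f : Lp ℂ 1 μ => AEStronglyMeasurable (fun s => f s • leftTranslate μ p s g) μ)
      ?_ ?_ ?_ f
    · intro c A hA hAμ
      have hK : ∀ n : ℕ, ∃ K ⊆ A, IsCompact K ∧ μ (A \ K) < ENNReal.ofReal (1 / ((n : ℝ) + 1)) :=
        fun n => hA.exists_isCompact_sdiff_lt hAμ.ne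
          (ENNReal.ofReal_pos.2 Nat.one_div_pos_of_nat).ne'
      choose K hKA hKc hKμ using hK
      have hnull : μ (A \ ⋃ n, K n) = 0 := by
        refine le_antisymm (ge_of_tendsto' (f := fun n : ℕ => ENNReal.ofReal (1 / ((n : ℝ) + 1)))
          (x := atTop) ?_ fun n => ?_) zero_le
        · simpa using ENNReal.tendsto_ofReal (tendsto_one_div_add_atTop_nhds_zero_nat (𝕜 := ℝ))
        · exact (measure_mono (Set.sdiff_subset_sdiff_right (Set.subset_iUnion K n))).trans (hKμ n).le
      have hae : (⋃ n, K n : Set G) =ᵐ[μ] A :=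
        (LE.le.eventuallyLE (Set.iUnion_subset hKA)).antisymm (ae_le_set.2 hnull)
      have h1 : AEStronglyMeasurable (fun s => leftTranslate μ p s g) (μ.restrict A) := by
        rw [← Measure.restrict_congr_set hae, aestronglyMeasurable_iUnion_iff]
        exact fun n => (continuous_leftTranslate μ p g).continuousOn.aestronglyMeasurable_of_isCompact
          (hKc n) (hKc n).measurableSet
      refine ((aestronglyMeasurable_indicator_iff hA).2 (h1.const_smul c)).congr ?_
      rw [Lp.simpleFunc.coe_indicatorConst]
      filter_upwards [indicatorConstLp_coeFn (p := 1) (hs := hA) (hμs := hAμ.ne) (c := c)]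
        with s hs
      rw [hs]
      by_cases hsA : s ∈ A <;> simp [hsA]
    · intro f₁ f₂ hf₁ hf₂ _ h₁ h₂
      refine (h₁.add h₂).congr ?_
      filter_upwards [Lp.coeFn_add (hf₁.toLp f₁) (hf₂.toLp f₂)] with s hs
      rw [hs, Pi.add_apply, Pi.add_apply, add_smul]
    · refine IsSeqClosed.isClosed fun φ f₀ hφ hlim => ?_
      obtain ⟨ns, -, hns⟩ := (tendstoInMeasure_of_tendsto_Lp hlim).exists_seq_tendsto_ae
      refine aestronglyMeasurable_of_tendsto_ae atTop (fun n => hφ (ns n)) ?_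
      filter_upwards [hns] with s hs
      exact hs.smul_const _
  refine (((memLp_one_iff_integrable.1 (Lp.memLp f)).norm).mul_const ‖g‖).mono' hmeas ?_
  refine Eventually.of_forall fun s => ?_
  rw [norm_smul, norm_leftTranslate]

/-- `λ_p : L^1(G) → B(L^p(G))`, `1 ≤ p < ∞`, `λ_p(f) g = f * g`. The convolution
`f * g = ∫ f(s) g(s⁻¹ ·) dμ(s)` is taken as an `L^p(G)`-valued Bochner integral. -/
def lam (p : ℝ≥0∞) [Fact (1 ≤ p)] [Fact (p ≠ ∞)] :
    Lp ℂ 1 μ →L[ℂ] Lp ℂ p μ →L[ℂ] Lp ℂ p μ :=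
  LinearMap.mkContinuous₂
    (LinearMap.mk₂ ℂ (fun (f : Lp ℂ 1 μ) (g : Lp ℂ p μ) => ∫ s, f s • leftTranslate μ p s g ∂μ)
      (by
        intro f₁ f₂ g
        rw [← integral_add (integrable_smul_leftTranslate μ p f₁ g)
          (integrable_smul_leftTranslate μ p f₂ g)]
        refine integral_congr_ae ?_
        filter_upwards [Lp.coeFn_add f₁ f₂] with s hs
        rw [hs, Pi.add_apply, add_smul])
      (by
        intro c f g
        rw [← integral_smul]
        refine integral_congr_ae ?_
        filter_upwards [Lp.coeFn_smul c f] with s hs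
        rw [hs, Pi.smul_apply, smul_assoc])
      (by
        intro f g₁ g₂
        rw [← integral_add (integrable_smul_leftTranslate μ p f g₁)
          (integrable_smul_leftTranslate μ p f g₂)]
        refine integral_congr_ae (Eventually.of_forall fun s => ?_)
        simp only [leftTranslate, smul_add])
      (by
        intro c f g
        rw [← integral_smul]
        refine integral_congr_ae (Eventually.of_forall fun s => ?_)
        simp only [leftTranslate]
        rw [smul_comm (DomMulAct.mk s⁻¹) c g, smul_comm (f s) c]))
    1 (by
      intro f g
      rw [LinearMap.mk₂_apply, one_mul]
      refine (norm_integral_le_integral_norm _).trans ?_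
      simp only [norm_smul, norm_leftTranslate]
      rw [integral_mul_const, L1.norm_eq_integral_norm])

theorem lam_apply (p : ℝ≥0∞) [Fact (1 ≤ p)] [Fact (p ≠ ∞)] (f : Lp ℂ 1 μ) (g : Lp ℂ p μ) :
    lam μ p f g = ∫ s, f s • leftTranslate μ p s g ∂μ := rfl

/-- On continuous compactly supported functions `λ_p(f) g` is the pointwise convolution. -/
theorem lam_ccToLp (p : ℝ≥0∞) [Fact (1 ≤ p)] [Fact (p ≠ ∞)] (f g : C_c(G, ℂ)) :
    lam μ p (ccToLp μ 1 f) (ccToLp μ p g) = ccToLp μ p (convCc μ f g) := by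
  have hp1 : 1 ≤ p := Fact.out
  have hpt : p ≠ ∞ := Fact.out
  have hcc : ∀ (r : ℝ≥0∞) (h : C_c(G, ℂ)), ccToLp μ r h =ᵐ[μ] h := fun r h => MemLp.coeFn_toLp _
  have hfin : ∀ (h : Lp ℂ p μ) (s : Set G), MeasurableSet s → μ s < ∞ → IntegrableOn h s μ := by
    intro h s _ hs
    have : IsFiniteMeasure (μ.restrict s) := ⟨by simpa using hs⟩
    exact ((Lp.memLp h).restrict s).integrable hp1
  apply Lp.ext
  refine Lp.ae_eq_of_forall_setIntegral_eq _ _ (by positivity) hpt (hfin _) (hfin _) ?_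
  intro A hA hAμ
  obtain ⟨r, hr⟩ : ∃ r : ℝ≥0∞, ENNReal.HolderConjugate p r :=
    ⟨ENNReal.conjExponent p, ENNReal.HolderConjugate.conjExponent hp1⟩
  have : Fact (1 ≤ r) := ⟨ENNReal.HolderConjugate.one_le r p⟩
  let S : Lp ℂ p μ →L[ℂ] ℂ :=
    (ContinuousLinearMap.lpPairing μ p r (ContinuousLinearMap.mul ℂ ℂ)).flip
      (indicatorConstLp r hA hAμ.ne (1 : ℂ))
  have hS : ∀ h : Lp ℂ p μ, S h = ∫ x in A, h x ∂μ := by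
    intro h
    simp only [S, ContinuousLinearMap.flip_apply, ContinuousLinearMap.lpPairing_eq_integral,
      ContinuousLinearMap.mul_apply']
    rw [← integral_indicator hA]
    refine integral_congr_ae ?_
    filter_upwards [indicatorConstLp_coeFn (p := r) (hs := hA) (hμs := hAμ.ne) (c := (1 : ℂ))]
      with x hx
    rw [hx]
    by_cases hxA : x ∈ A <;> simp [hxA]
  rw [← hS, lam_apply,
    ← ContinuousLinearMap.integral_comp_comm S (integrable_smul_leftTranslate μ p _ _)]
  have h1 : ∀ s, S (leftTranslate μ p s (ccToLp μ p g)) = ∫ x in A, g (s⁻¹ * x) ∂μ := by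
    intro s
    rw [hS]
    refine integral_congr_ae (ae_restrict_of_ae ?_)
    have h2 : ∀ᵐ x ∂μ, ccToLp μ p g (s⁻¹ * x) = g (s⁻¹ * x) :=
      (measurePreserving_mul_left μ s⁻¹).quasiMeasurePreserving.ae (hcc p g)
    filter_upwards [leftTranslate_ae μ p s (ccToLp μ p g), h2] with x hx hx2
    rw [hx, hx2]
  have h3 : ∫ s, S (ccToLp μ 1 f s • leftTranslate μ p s (ccToLp μ p g)) ∂μ
      = ∫ s, ∫ x in A, f s * g (s⁻¹ * x) ∂μ ∂μ := by
    refine integral_congr_ae ?_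
    filter_upwards [hcc 1 f] with s hs
    rw [map_smul, h1, hs, smul_eq_mul, integral_const_mul]
  have h4 : ∫ x in A, ccToLp μ p (convCc μ f g) x ∂μ
      = ∫ x in A, ∫ s, f s * g (s⁻¹ * x) ∂μ ∂μ :=
    integral_congr_ae (ae_restrict_of_ae (hcc p (convCc μ f g)))
  rw [h3, h4]
  refine integral_integral_swap_of_hasCompactSupport
    (f := fun s x => f s * g (s⁻¹ * x)) ?_ ?_
  · exact (f.continuous.comp continuous_fst).mul
      (g.continuous.comp (continuous_fst.inv.mul continuous_snd))
  · have hfc : IsCompact (tsupport f) := f.hasCompactSupport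
    have hgc : IsCompact (tsupport g) := g.hasCompactSupport
    refine HasCompactSupport.intro (hfc.prod (hfc.mul hgc)) ?_
    rintro ⟨s, x⟩ hsx
    by_contra hne
    apply hsx
    have h1 : f s ≠ 0 := fun h0 => hne (by simp [Function.uncurry, h0])
    have h2 : g (s⁻¹ * x) ≠ 0 := fun h0 => hne (by simp [Function.uncurry, h0])
    exact ⟨subset_tsupport _ h1,
      Set.mem_mul.2 ⟨s, subset_tsupport _ h1, s⁻¹ * x, subset_tsupport _ h2,
        mul_inv_cancel_left s x⟩⟩

/-- The group algebra `L^1(G)`, to be normed by `max {‖λ_p(f)‖, ‖λ_q(f)‖}`. -/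
@[nolint unusedArguments]
def PFPre (μ : Measure G) (_p _q : ℝ≥0∞) : Type _ := Lp ℂ 1 μ

instance (p q : ℝ≥0∞) : AddCommGroup (PFPre μ p q) := inferInstanceAs (AddCommGroup (Lp ℂ 1 μ))

instance (p q : ℝ≥0∞) : Module ℂ (PFPre μ p q) := inferInstanceAs (Module ℂ (Lp ℂ 1 μ))

variable (p q : ℝ≥0∞) [Fact (1 ≤ p)] [Fact (p ≠ ∞)] [Fact (1 ≤ q)] [Fact (q ≠ ∞)]

/-- `f ↦ (λ_p(f), λ_q(f))`. -/
def lamProd : PFPre μ p q →ₗ[ℂ]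
    (Lp ℂ p μ →L[ℂ] Lp ℂ p μ) × (Lp ℂ q μ →L[ℂ] Lp ℂ q μ) :=
  LinearMap.prod (lam μ p).toLinearMap (lam μ q).toLinearMap

instance : SeminormedAddCommGroup (PFPre μ p q) := SeminormedAddCommGroup.induced _ _ (lamProd μ p q)

instance : NormedSpace ℂ (PFPre μ p q) := NormedSpace.induced ℂ _ _ (lamProd μ p q)

/-- An element of `L^1(G)`, regarded as an element of the renormed space. -/
def toPFPre (f : Lp ℂ 1 μ) : PFPre μ p q := f

theorem norm_toPFPre (f : Lp ℂ 1 μ) : ‖toPFPre μ p q f‖ = max ‖lam μ p f‖ ‖lam μ q f‖ := rfl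

/-- The (underlying Banach space of the) symmetrized algebra of `p`-pseudofunctions `PF_p^*(G)`,
where `q` is the exponent conjugate to `p`: the completion of `L^1(G)` with respect to the norm
`max {‖λ_p(f)‖, ‖λ_q(f)‖}`. -/
abbrev PFStar : Type _ := UniformSpace.Completion (PFPre μ p q)

/-- The canonical map `L^1(G) → PF_p^*(G)`. -/
def toPFStar (f : Lp ℂ 1 μ) : PFStar μ p q := (toPFPre μ p q f : UniformSpace.Completion _)

end Regular

end KunzeStein

end

/-! Both bounds come from interpolating the Kunze–Stein estimate `L^r × L^2 → L^2` with a trivial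
one: `L^1 × L^1 → L^1` for the target `L^q`, and `L^1 × L^∞ → L^∞` for the target `L^p`. The same
parameter `θ = 2/p` serves both, since `1/q = (1 - θ) + θ/2` and `1/p = θ/2`. In the first variable
`1/s = (1 - θ) + θ/r` determines `r`, and `s < q` is exactly what makes `r < 2`.

No complex interpolation is needed, because convolution has a positive kernel. Hölder in the
integration variable (`enorm_conv_le_geom_mean`) bounds `|f * g|` pointwise by a geometric mean of
integrals of powers of `|f|` and `|g|`. A second Hölder, in the outer variable, turns this into a
norm estimate, and the endpoint bounds are applied to the powers (`ConvBound.interpolate_one`,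
`ConvBound.interpolate_top`).

The resulting inequalities on `C_c(G)` say that `f ↦ λ_p(f)` and `f ↦ λ_q(f)` are bounded for the
`L^s` norm, so density of `C_c(G)` gives the bilinear extensions and the map into the completion. -/

noncomputable section

namespace KunzeStein

/-! ### Norms of geometric means. -/

/-- Hölder's inequality for functions dominated by a geometric mean of an `L¹` and an `L²`
function. -/
theorem eLpNorm_le_of_enorm_le_geom_mean {α : Type*} [MeasurableSpace α] {ν : Measure α}
    {h u v : α → ℂ} (hu : AEMeasurable u ν) (hv : AEMeasurable v ν) {q : ℝ≥0∞} (hq : q ≠ 0)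
    (hqt : q ≠ ∞) {θ : ℝ} (hθ0 : 0 ≤ θ) (hθ1 : θ ≤ 1) (hθ : q.toReal * (1 - θ / 2) = 1)
    (hle : ∀ x, ‖h x‖ₑ ≤ ‖u x‖ₑ ^ (1 - θ) * ‖v x‖ₑ ^ θ) :
    eLpNorm h q ν ≤ eLpNorm u 1 ν ^ (1 - θ) * eLpNorm v 2 ν ^ θ := by
  have hQ : 0 < q.toReal := ENNReal.toReal_pos hq hqt
  have hθ' : 0 ≤ 1 - θ := by linarith
  rw [eLpNorm_eq_lintegral_rpow_enorm_toReal hq hqt,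
    eLpNorm_eq_lintegral_rpow_enorm_toReal two_ne_zero ENNReal.ofNat_ne_top,
    eLpNorm_one_eq_lintegral_enorm, one_div, ENNReal.rpow_inv_le_iff hQ]
  -- The Hölder weights `q(1 - θ)` and `qθ/2` sum to `1` by `hθ`.
  calc ∫⁻ x, ‖h x‖ₑ ^ q.toReal ∂ν
      ≤ ∫⁻ x, ‖u x‖ₑ ^ (q.toReal * (1 - θ)) * (‖v x‖ₑ ^ (2 : ℝ)) ^ (q.toReal * θ / 2) ∂ν := by
        refine lintegral_mono fun x => ?_
        refine (ENNReal.rpow_le_rpow (hle x) hQ.le).trans_eq ?_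
        rw [ENNReal.mul_rpow_of_nonneg _ _ hQ.le, ← ENNReal.rpow_mul, ← ENNReal.rpow_mul,
          ← ENNReal.rpow_mul]
        congr 2 <;> ring
    _ ≤ (∫⁻ x, ‖u x‖ₑ ∂ν) ^ (q.toReal * (1 - θ)) *
          (∫⁻ x, ‖v x‖ₑ ^ (2 : ℝ) ∂ν) ^ (q.toReal * θ / 2) :=
        ENNReal.lintegral_mul_norm_pow_le hu.enorm (hv.enorm.pow_const _) (by positivity)
          (by positivity) (by linarith)
    _ = _ := by
        rw [ENNReal.mul_rpow_of_nonneg _ _ hQ.le, ← ENNReal.rpow_mul, ← ENNReal.rpow_mul,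
          ← ENNReal.rpow_mul, ENNReal.toReal_ofNat]
        congr 2 <;> ring

/-- The `L^p` norm of a function dominated by a geometric mean of a constant and an `L²`
function. -/
theorem eLpNorm_le_of_enorm_le_const_geom_mean {α : Type*} [MeasurableSpace α] {ν : Measure α}
    {h v : α → ℂ} (hv : AEMeasurable v ν) {p : ℝ≥0∞} (hp : p ≠ 0) (hpt : p ≠ ∞) {θ : ℝ}
    (hθ1 : θ ≤ 1) (hθ : p.toReal * θ = 2) {c : ℝ≥0∞}
    (hle : ∀ x, ‖h x‖ₑ ≤ c ^ (1 - θ) * ‖v x‖ₑ ^ θ) :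
    eLpNorm h p ν ≤ c ^ (1 - θ) * eLpNorm v 2 ν ^ θ := by
  have hP : 0 < p.toReal := ENNReal.toReal_pos hp hpt
  have hθ' : 0 ≤ 1 - θ := by linarith
  rw [eLpNorm_eq_lintegral_rpow_enorm_toReal hp hpt,
    eLpNorm_eq_lintegral_rpow_enorm_toReal two_ne_zero ENNReal.ofNat_ne_top,
    one_div, ENNReal.rpow_inv_le_iff hP]
  calc ∫⁻ x, ‖h x‖ₑ ^ p.toReal ∂ν
      ≤ ∫⁻ x, (c ^ (1 - θ)) ^ p.toReal * ‖v x‖ₑ ^ (2 : ℝ) ∂ν := by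
        refine lintegral_mono fun x => ?_
        refine (ENNReal.rpow_le_rpow (hle x) hP.le).trans_eq ?_
        rw [ENNReal.mul_rpow_of_nonneg _ _ hP.le, ← ENNReal.rpow_mul (‖v x‖ₑ), mul_comm θ, hθ]
    _ = (c ^ (1 - θ)) ^ p.toReal * ∫⁻ x, ‖v x‖ₑ ^ (2 : ℝ) ∂ν :=
        lintegral_const_mul'' _ (hv.enorm.pow_const _)
    _ = _ := by
        rw [ENNReal.mul_rpow_of_nonneg _ _ hP.le, ← ENNReal.rpow_mul (∫⁻ x, _ ∂ν),
          ← ENNReal.rpow_mul (∫⁻ x, _ ∂ν), ENNReal.toReal_ofNat, mul_assoc, mul_comm θ, hθ]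
        norm_num

variable {G : Type*} [Group G] [TopologicalSpace G] [IsTopologicalGroup G]
  [LocallyCompactSpace G] [T2Space G] [MeasurableSpace G] [BorelSpace G]

/-! ### Powers of test functions and pointwise Hölder for convolution. -/

/-- The power `|f|^a`, `a > 0`, of a continuous compactly supported function. -/
def absRpow (f : C_c(G, ℂ)) (a : ℝ) (ha : 0 < a) : C_c(G, ℂ) where
  toFun x := ((‖f x‖ ^ a : ℝ) : ℂ)
  continuous_toFun :=
    Complex.continuous_ofReal.comp (f.continuous.norm.rpow_const fun _ => Or.inr ha.le)
  hasCompactSupport' := f.hasCompactSupport.comp_left (g := fun z : ℂ => ((‖z‖ ^ a : ℝ) : ℂ))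
    (by simp [Real.zero_rpow ha.ne'])

theorem absRpow_apply (f : C_c(G, ℂ)) (a : ℝ) (ha : 0 < a) (x : G) :
    absRpow f a ha x = ((‖f x‖ ^ a : ℝ) : ℂ) := rfl

theorem eLpNorm_absRpow (μ : Measure G) (f : C_c(G, ℂ)) (a : ℝ) (ha : 0 < a) (r : ℝ≥0∞) :
    eLpNorm (absRpow f a ha) r μ = eLpNorm f (r * ENNReal.ofReal a) μ ^ a := by
  rw [← eLpNorm_norm_rpow f ha]
  refine eLpNorm_congr_norm_ae (Eventually.of_forall fun x => ?_)
  rw [absRpow_apply, Complex.norm_real]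

theorem enorm_conv_le (μ : Measure G) (f g : G → ℂ) (x : G) :
    ‖conv μ f g x‖ₑ ≤ ∫⁻ y, ‖f y‖ₑ * ‖g (y⁻¹ * x)‖ₑ ∂μ := by
  refine (enorm_integral_le_lintegral_enorm _).trans_eq ?_
  simp only [enorm_mul]

/-- The integrand is nonnegative, so nothing is lost to cancellation. This equality lets a norm
bound for complex convolutions control the positive integrals produced by Hölder. -/
theorem enorm_conv_absRpow (μ : Measure G) [IsFiniteMeasureOnCompacts μ] (f g : C_c(G, ℂ))
    {a b : ℝ} (ha : 0 < a) (hb : 0 < b) (x : G) :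
    ‖conv μ (absRpow f a ha) (absRpow g b hb) x‖ₑ
      = ∫⁻ y, ‖f y‖ₑ ^ a * ‖g (y⁻¹ * x)‖ₑ ^ b ∂μ := by
  have h0 : ∀ y, 0 ≤ ‖f y‖ ^ a * ‖g (y⁻¹ * x)‖ ^ b := fun y => by positivity
  have hc : Continuous fun y => ‖f y‖ ^ a * ‖g (y⁻¹ * x)‖ ^ b :=
    (f.continuous.norm.rpow_const fun _ => Or.inr ha.le).mul
      ((g.continuous.comp (continuous_inv.mul continuous_const)).norm.rpow_const
        fun _ => Or.inr hb.le)
  have hint : Integrable (fun y => ‖f y‖ ^ a * ‖g (y⁻¹ * x)‖ ^ b) μ := by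
    refine hc.integrable_of_hasCompactSupport ?_
    exact (f.hasCompactSupport.comp_left (g := fun z : ℂ => ‖z‖ ^ a)
      (by simp [Real.zero_rpow ha.ne'])).mul_right
  have h1 : conv μ (absRpow f a ha) (absRpow g b hb) x
      = ((∫ y, ‖f y‖ ^ a * ‖g (y⁻¹ * x)‖ ^ b ∂μ : ℝ) : ℂ) := by
    rw [conv, ← integral_complex_ofReal]
    simp only [absRpow_apply, Complex.ofReal_mul]
  rw [h1, ← ofReal_norm, Complex.norm_real, Real.norm_of_nonneg (integral_nonneg h0),
    ofReal_integral_eq_lintegral_ofReal hint (Eventually.of_forall h0)]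
  refine lintegral_congr fun y => ?_
  rw [ENNReal.ofReal_mul (by positivity), ← ENNReal.ofReal_rpow_of_nonneg (norm_nonneg _) ha.le,
    ← ENNReal.ofReal_rpow_of_nonneg (norm_nonneg _) hb.le, ofReal_norm, ofReal_norm]

/-- Hölder's inequality for the convolution product. -/
theorem enorm_conv_le_geom_mean (μ : Measure G) (f g : C_c(G, ℂ)) {a₀ b₀ a₁ b₁ θ : ℝ}
    (ha₀ : 0 ≤ a₀) (hb₀ : 0 ≤ b₀) (ha₁ : 0 ≤ a₁) (hb₁ : 0 ≤ b₁) (hθ0 : 0 ≤ θ) (hθ1 : θ ≤ 1)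
    (ha : a₀ * (1 - θ) + a₁ * θ = 1) (hb : b₀ * (1 - θ) + b₁ * θ = 1) (x : G) :
    ‖conv μ f g x‖ₑ ≤ (∫⁻ y, ‖f y‖ₑ ^ a₀ * ‖g (y⁻¹ * x)‖ₑ ^ b₀ ∂μ) ^ (1 - θ) *
      (∫⁻ y, ‖f y‖ₑ ^ a₁ * ‖g (y⁻¹ * x)‖ₑ ^ b₁ ∂μ) ^ θ := by
  have hθ' : 0 ≤ 1 - θ := by linarith
  have hm : ∀ a b : ℝ, AEMeasurable (fun y => ‖f y‖ₑ ^ a * ‖g (y⁻¹ * x)‖ₑ ^ b) μ := fun a b =>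
    ((f.continuous.measurable.enorm.pow_const a).mul
      ((g.continuous.comp (continuous_inv.mul continuous_const)).measurable.enorm.pow_const
        b)).aemeasurable
  -- Exponents may vanish here: the `L^∞` endpoint uses `b₀ = 0`.
  have key : ∀ (z : ℝ≥0∞) {a b : ℝ}, 0 ≤ a → 0 ≤ b → a * (1 - θ) + b * θ = 1 →
      z = (z ^ a) ^ (1 - θ) * (z ^ b) ^ θ := fun z a b h1 h2 h => by
    rw [← ENNReal.rpow_mul, ← ENNReal.rpow_mul,
      ← ENNReal.rpow_add_of_nonneg _ _ (by positivity) (by positivity), h, ENNReal.rpow_one]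
  refine (enorm_conv_le μ f g x).trans ?_
  refine le_trans (le_of_eq ?_)
    (ENNReal.lintegral_mul_norm_pow_le (hm a₀ b₀) (hm a₁ b₁) hθ' hθ0 (by ring))
  refine lintegral_congr fun y => ?_
  rw [ENNReal.mul_rpow_of_nonneg _ _ hθ', ENNReal.mul_rpow_of_nonneg _ _ hθ0, mul_mul_mul_comm,
    ← key _ ha₀ ha₁ ha, ← key _ hb₀ hb₁ hb]

/-! ### Density of `C_c(G)` in `L^r(G)`. -/

theorem enorm_ccToLp (μ : Measure G) [IsFiniteMeasureOnCompacts μ] (r : ℝ≥0∞) (f : C_c(G, ℂ)) :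
    ‖ccToLp μ r f‖ₑ = eLpNorm f r μ := by
  rw [ccToLp, Lp.enorm_toLp]

/-- The class in `L^r(G)` of a continuous compactly supported function, as a linear map. -/
def ccToLpₗ (μ : Measure G) [IsFiniteMeasureOnCompacts μ] (r : ℝ≥0∞) :
    C_c(G, ℂ) →ₗ[ℂ] Lp ℂ r μ where
  toFun := ccToLp μ r
  map_add' _ _ := rfl
  map_smul' _ _ := rfl

/-- Indicators of sets of finite measure are approximated in `L^r` by continuous compactly supported
functions. -/
theorem exists_cc_eLpNorm_sub_indicator_le (μ : Measure G) [μ.Regular] {r : ℝ≥0∞} (hr : r ≠ ∞)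
    (c : ℂ) {t : Set G} (ht : MeasurableSet t) (htμ : μ t ≠ ∞) {ε : ℝ≥0∞} (hε : ε ≠ 0) :
    ∃ f : C_c(G, ℂ), eLpNorm (⇑f - t.indicator fun _ => c) r μ ≤ ε := by
  obtain ⟨η, ηpos, hη⟩ := exists_eLpNorm_indicator_le (μ := μ) hr c hε
  have hη2 : (η : ℝ≥0∞) / 2 ≠ 0 := (ENNReal.half_pos (ENNReal.coe_ne_zero.2 ηpos.ne')).ne'
  obtain ⟨s, st, hsc, hsμ⟩ := ht.exists_isCompact_sdiff_lt htμ hη2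
  obtain ⟨V, sV, hV, -, hVμ⟩ :=
    hsc.measurableSet.exists_isOpen_sdiff_lt (ne_top_of_le_ne_top htμ (measure_mono st)) hη2
  obtain ⟨g, hg1, hg0, hgc, hg01⟩ := exists_continuous_one_zero_of_isCompact hsc hV.isClosed_compl
    (Set.disjoint_compl_right_iff_subset.2 sV)
  let f : C_c(G, ℂ) := ⟨⟨fun x => (g x : ℂ) * c, by fun_prop⟩,
    hgc.comp_left (g := fun y : ℝ => (y : ℂ) * c) (by simp)⟩
  -- The error vanishes off `V \ s ∪ t \ s` and is at most `‖c‖` there; `V` need not contain `t`.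
  refine ⟨f, le_trans (eLpNorm_mono fun x => ?_) (hη (V \ s ∪ t \ s) ?_)⟩
  · have hfx : f x = (g x : ℂ) * c := rfl
    have h0 := (hg01 x).1
    have h1 := (hg01 x).2
    rw [Pi.sub_apply, hfx]
    by_cases hs : x ∈ s
    · simp [hg1 hs, st hs]
    by_cases hxt : x ∈ t
    · rw [Set.indicator_of_mem hxt, Set.indicator_of_mem (show x ∈ V \ s ∪ t \ s from Or.inr ⟨hxt, hs⟩), ← sub_one_mul,
        norm_mul, ← Complex.ofReal_one, ← Complex.ofReal_sub, Complex.norm_real]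
      refine mul_le_of_le_one_left (norm_nonneg _) ?_
      rw [Real.norm_eq_abs, abs_le]
      constructor <;> linarith
    rw [Set.indicator_of_notMem hxt, sub_zero]
    by_cases hxV : x ∈ V
    · rw [Set.indicator_of_mem (show x ∈ V \ s ∪ t \ s from Or.inl ⟨hxV, hs⟩), norm_mul, Complex.norm_real]
      refine mul_le_of_le_one_left (norm_nonneg _) ?_
      rwa [Real.norm_of_nonneg h0]
    · simp [hg0 hxV]
  · refine (measure_union_le _ _).trans ((add_le_add hVμ.le hsμ.le).trans_eq ?_)
    exact ENNReal.add_halves _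

/-- `C_c(G)` is dense in `L^r(G)` for `1 ≤ r < ∞`. -/
theorem denseRange_ccToLpₗ (μ : Measure G) [μ.Regular] (r : ℝ≥0∞)
    [Fact (1 ≤ r)] (hr : r ≠ ∞) : DenseRange (ccToLpₗ μ r) := by
  refine EMetric.dense_iff.2 fun F ε hε => ?_
  obtain ⟨δ, hδ0, hδ⟩ := exists_between hε
  obtain ⟨-, hle, f, rfl⟩ := (Lp.memLp F).induction_dense hr
    (fun h => ∃ f : C_c(G, ℂ), ⇑f = h)
    (fun c t ht htμ ε hε => by
      obtain ⟨f, hf⟩ := exists_cc_eLpNorm_sub_indicator_le μ hr c ht htμ.ne hε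
      exact ⟨f, hf, f, rfl⟩)
    (by
      rintro - - ⟨f, rfl⟩ ⟨g, rfl⟩
      exact ⟨f + g, rfl⟩)
    (by
      rintro - ⟨f, rfl⟩
      exact (f.continuous.memLp_of_hasCompactSupport (μ := μ) (p := r)
        f.hasCompactSupport).aestronglyMeasurable)
    hδ0.ne'
  refine ⟨ccToLpₗ μ r f, ?_, f, rfl⟩
  rw [Metric.mem_eball, edist_comm, Lp.edist_def]
  refine lt_of_le_of_lt (le_trans (le_of_eq (eLpNorm_congr_ae ?_)) hle) hδ
  exact (EventuallyEq.refl _ _).sub (MemLp.coeFn_toLp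
    (f.continuous.memLp_of_hasCompactSupport f.hasCompactSupport))

/-! ### From inequalities on `C_c(G)` to bounded extensions. -/

theorem mul_ofReal_toReal_div {r s : ℝ≥0∞} (hr0 : r ≠ 0) (hrt : r ≠ ∞) (hst : s ≠ ∞) :
    r * ENNReal.ofReal (s.toReal / r.toReal) = s := by
  rw [← ENNReal.toReal_div, ENNReal.ofReal_toReal (ENNReal.div_ne_top hst hr0),
    ENNReal.mul_div_cancel hr0 hrt]

theorem two_mul_ofReal_toReal_div_two {s : ℝ≥0∞} (hs : s ≠ ∞) :
    2 * ENNReal.ofReal (s.toReal / 2) = s := by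
  simpa using mul_ofReal_toReal_div two_ne_zero ENNReal.ofNat_ne_top hs

/-- The bound `‖f * g‖_s ≤ C ‖f‖_r ‖g‖_s` on `C_c(G)`. -/
def ConvBound (μ : Measure G) (r s : ℝ≥0∞) : Prop :=
  ∃ C : ℝ≥0∞, C ≠ ∞ ∧ ∀ f g : C_c(G, ℂ),
    eLpNorm (conv μ f g) s μ ≤ C * eLpNorm f r μ * eLpNorm g s μ

theorem ConvExtends.convBound {μ : Measure G} [IsFiniteMeasureOnCompacts μ] {r s : ℝ≥0∞}
    [Fact (1 ≤ r)] [Fact (1 ≤ s)] (h : ConvExtends μ r s) : ConvBound μ r s := by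
  obtain ⟨B, hB⟩ := h
  refine ⟨‖B‖ₑ, enorm_ne_top, fun f g => ?_⟩
  have := (B (ccToLp μ r f)).le_opENorm (ccToLp μ s g)
  rw [hB, enorm_ccToLp, enorm_ccToLp] at this
  refine this.trans ?_
  gcongr
  rw [← enorm_ccToLp]
  exact B.le_opENorm _

section Regular

variable (μ : Measure G) [μ.IsHaarMeasure] [μ.Regular]

theorem norm_lam_le (p : ℝ≥0∞) [Fact (1 ≤ p)] [Fact (p ≠ ∞)] : ‖lam μ p‖ ≤ 1 :=
  LinearMap.mkContinuous₂_norm_le _ zero_le_one _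

theorem eLpNorm_conv_one_le (f g : C_c(G, ℂ)) :
    eLpNorm (conv μ f g) 1 μ ≤ eLpNorm f 1 μ * eLpNorm g 1 μ := by
  have : Fact ((1 : ℝ≥0∞) ≠ ∞) := ⟨ENNReal.one_ne_top⟩
  have h := (lam μ 1 (ccToLp μ 1 f)).le_opENorm (ccToLp μ 1 g)
  rw [lam_ccToLp, enorm_ccToLp, enorm_ccToLp] at h
  refine h.trans ?_
  gcongr
  rw [← enorm_ccToLp]
  refine ((lam μ 1).le_opENorm _).trans (mul_le_of_le_one_left zero_le ?_)
  have h1 : ‖lam μ 1‖ ≤ 1 := norm_lam_le μ 1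
  rw [← ofReal_norm]
  exact ENNReal.ofReal_le_one.2 h1

/-- For fixed `f` the operator is already continuous on `L^p`, so the inequality passes from test
functions `g` to all of `L^p` by density. Only the dependence on `f` is then left to extend. -/
theorem norm_lam_ccToLp_le {r p : ℝ≥0∞} [Fact (1 ≤ r)] [Fact (1 ≤ p)] [Fact (p ≠ ∞)]
    (h : ConvBound μ r p) :
    ∃ C : ℝ, 0 ≤ C ∧ ∀ f : C_c(G, ℂ), ‖lam μ p (ccToLp μ 1 f)‖ ≤ C * ‖ccToLp μ r f‖ := by
  obtain ⟨C, hC, hb⟩ := h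
  refine ⟨C.toReal, ENNReal.toReal_nonneg, fun f => ?_⟩
  refine ContinuousLinearMap.opNorm_le_bound _
    (mul_nonneg ENNReal.toReal_nonneg (norm_nonneg _)) fun g => ?_
  refine (denseRange_ccToLpₗ μ p Fact.out).induction_on (p := fun g =>
    ‖lam μ p (ccToLp μ 1 f) g‖ ≤ C.toReal * ‖ccToLp μ r f‖ * ‖g‖) g ?_ fun g => ?_
  · exact isClosed_le (by fun_prop) (by fun_prop)
  · have key : ‖lam μ p (ccToLp μ 1 f) (ccToLp μ p g)‖ₑ
        ≤ C * ‖ccToLp μ r f‖ₑ * ‖ccToLp μ p g‖ₑ := by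
      rw [lam_ccToLp, enorm_ccToLp, enorm_ccToLp, enorm_ccToLp]
      exact hb f g
    have := ENNReal.toReal_mono (by finiteness) key
    rwa [ENNReal.toReal_mul, ENNReal.toReal_mul, toReal_enorm, toReal_enorm, toReal_enorm] at this

/-- The extension is taken in `f` alone, with values in the Banach space of operators on `L^p`. -/
theorem ConvBound.convExtends {r p : ℝ≥0∞} [Fact (1 ≤ r)] [Fact (1 ≤ p)] (hr : r ≠ ∞)
    [Fact (p ≠ ∞)] (h : ConvBound μ r p) : ConvExtends μ r p := by
  obtain ⟨C, -, hC⟩ := norm_lam_ccToLp_le μ h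
  let L : C_c(G, ℂ) →ₗ[ℂ] Lp ℂ p μ →L[ℂ] Lp ℂ p μ := (lam μ p).toLinearMap ∘ₗ ccToLpₗ μ 1
  refine ⟨L.extendOfNorm (ccToLpₗ μ r), fun f g => ?_⟩
  have := L.extendOfNorm_eq (denseRange_ccToLpₗ μ r hr) ⟨C, hC⟩ f
  exact (congrArg (fun T => T (ccToLp μ p g)) this).trans (lam_ccToLp μ p f g)

theorem ConvBound.exists_extension_PFStar {r p q : ℝ≥0∞} [Fact (1 ≤ r)] (hr : r ≠ ∞)
    [Fact (1 ≤ p)] [Fact (p ≠ ∞)] [Fact (1 ≤ q)] [Fact (q ≠ ∞)]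
    (h : ConvBound μ r p) (h' : ConvBound μ r q) :
    ∃ Φ : Lp ℂ r μ →L[ℂ] PFStar μ p q,
      ∀ f : C_c(G, ℂ), Φ (ccToLp μ r f) = toPFStar μ p q (ccToLp μ 1 f) := by
  obtain ⟨C, hC0, hC⟩ := norm_lam_ccToLp_le μ h
  obtain ⟨D, hD0, hD⟩ := norm_lam_ccToLp_le μ h'
  let L : C_c(G, ℂ) →ₗ[ℂ] PFStar μ p q :=
    { toFun := fun f => toPFStar μ p q (ccToLp μ 1 f)
      map_add' := fun f g => UniformSpace.Completion.coe_add
        (toPFPre μ p q (ccToLp μ 1 f)) (toPFPre μ p q (ccToLp μ 1 g))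
      map_smul' := fun c f => UniformSpace.Completion.coe_smul
        c (toPFPre μ p q (ccToLp μ 1 f)) }
  refine ⟨L.extendOfNorm (ccToLpₗ μ r), fun f => ?_⟩
  refine L.extendOfNorm_eq (denseRange_ccToLpₗ μ r hr) ⟨max C D, fun f => ?_⟩ f
  refine (UniformSpace.Completion.norm_coe (toPFPre μ p q (ccToLp μ 1 f))).trans_le ?_
  rw [norm_toPFPre]
  exact max_le
    ((hC f).trans (mul_le_mul_of_nonneg_right (le_max_left _ _) (norm_nonneg (ccToLp μ r f))))
    ((hD f).trans (mul_le_mul_of_nonneg_right (le_max_right _ _) (norm_nonneg (ccToLp μ r f))))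

/-! ### Interpolation with the trivial endpoints. -/

/-- Interpolation between `L¹ × L¹ → L¹` and `L^r × L² → L²`. -/
theorem ConvBound.interpolate_one {r : ℝ≥0∞} (hr0 : r ≠ 0) (hrt : r ≠ ∞) (h : ConvBound μ r 2)
    {s q : ℝ≥0∞} (hs0 : s ≠ 0) (hst : s ≠ ∞) (hq0 : q ≠ 0) (hqt : q ≠ ∞) {θ : ℝ} (hθ0 : 0 ≤ θ)
    (hθ1 : θ ≤ 1) (hs : s.toReal * (1 - θ) + s.toReal / r.toReal * θ = 1)
    (hq : q.toReal * (1 - θ / 2) = 1) : ConvBound μ s q := by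
  obtain ⟨C, hC, hb⟩ := h
  have hS : 0 < s.toReal := ENNReal.toReal_pos hs0 hst
  have hQ : 0 < q.toReal := ENNReal.toReal_pos hq0 hqt
  have hR : 0 < r.toReal := ENNReal.toReal_pos hr0 hrt
  have hSR : 0 < s.toReal / r.toReal := by positivity
  have hQ2 : 0 < q.toReal / 2 := by positivity
  have hθ' : 0 ≤ 1 - θ := by linarith
  refine ⟨C ^ θ, ENNReal.rpow_ne_top_of_nonneg hθ0 hC, fun f g => ?_⟩
  -- The powers are chosen so that every endpoint norm becomes a power of `‖f‖_s` or `‖g‖_q`.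
  have h1 := eLpNorm_conv_one_le μ (absRpow f _ hS) (absRpow g _ hQ)
  have h2 := hb (absRpow f _ hSR) (absRpow g _ hQ2)
  rw [eLpNorm_absRpow, eLpNorm_absRpow, one_mul, one_mul, ENNReal.ofReal_toReal hst,
    ENNReal.ofReal_toReal hqt] at h1
  rw [eLpNorm_absRpow, eLpNorm_absRpow, mul_ofReal_toReal_div hr0 hrt hst,
    two_mul_ofReal_toReal_div_two hqt] at h2
  refine (eLpNorm_le_of_enorm_le_geom_mean (continuous_conv μ _ _).measurable.aemeasurable
    (continuous_conv μ _ _).measurable.aemeasurable hq0 hqt hθ0 hθ1 hq fun x => ?_).trans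
    ((mul_le_mul' (ENNReal.rpow_le_rpow h1 hθ') (ENNReal.rpow_le_rpow h2 hθ0)).trans_eq ?_)
  · rw [enorm_conv_absRpow, enorm_conv_absRpow]
    exact enorm_conv_le_geom_mean μ f g hS.le hQ.le hSR.le hQ2.le hθ0 hθ1 hs (by linarith) x
  · rw [ENNReal.mul_rpow_of_nonneg _ _ hθ', ENNReal.mul_rpow_of_nonneg _ _ hθ0,
      ENNReal.mul_rpow_of_nonneg _ _ hθ0, ← ENNReal.rpow_mul, ← ENNReal.rpow_mul,
      ← ENNReal.rpow_mul, ← ENNReal.rpow_mul]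
    calc _ = C ^ θ * (eLpNorm f s μ ^ (s.toReal * (1 - θ)) *
            eLpNorm f s μ ^ (s.toReal / r.toReal * θ)) *
          (eLpNorm g q μ ^ (q.toReal * (1 - θ)) * eLpNorm g q μ ^ (q.toReal / 2 * θ)) := by ring
      _ = _ := by
        rw [← ENNReal.rpow_add_of_nonneg _ _ (by positivity) (by positivity),
          ← ENNReal.rpow_add_of_nonneg _ _ (by positivity) (by positivity), hs,
          show q.toReal * (1 - θ) + q.toReal / 2 * θ = 1 by linarith, ENNReal.rpow_one,
          ENNReal.rpow_one]

/-- Interpolation between `L¹ × L^∞ → L^∞` and `L^r × L² → L²`. -/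
theorem ConvBound.interpolate_top {r : ℝ≥0∞} (hr0 : r ≠ 0) (hrt : r ≠ ∞) (h : ConvBound μ r 2)
    {s p : ℝ≥0∞} (hs0 : s ≠ 0) (hst : s ≠ ∞) (hp0 : p ≠ 0) (hpt : p ≠ ∞) {θ : ℝ} (hθ0 : 0 ≤ θ)
    (hθ1 : θ ≤ 1) (hs : s.toReal * (1 - θ) + s.toReal / r.toReal * θ = 1)
    (hp : p.toReal * θ = 2) : ConvBound μ s p := by
  obtain ⟨C, hC, hb⟩ := h
  have hS : 0 < s.toReal := ENNReal.toReal_pos hs0 hst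
  have hP : 0 < p.toReal := ENNReal.toReal_pos hp0 hpt
  have hR : 0 < r.toReal := ENNReal.toReal_pos hr0 hrt
  have hSR : 0 < s.toReal / r.toReal := by positivity
  have hP2 : 0 < p.toReal / 2 := by positivity
  have hθ' : 0 ≤ 1 - θ := by linarith
  refine ⟨C ^ θ, ENNReal.rpow_ne_top_of_nonneg hθ0 hC, fun f g => ?_⟩
  -- At the `L^∞` endpoint `|g|` enters with power `0`, which is not compactly supported; the first
  -- Hölder factor is therefore computed directly, as a constant independent of `x`.
  have h1 : ∫⁻ y, ‖f y‖ₑ ^ s.toReal ∂μ = eLpNorm f s μ ^ s.toReal := by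
    rw [eLpNorm_eq_lintegral_rpow_enorm_toReal hs0 hst, ← ENNReal.rpow_mul,
      one_div_mul_cancel hS.ne', ENNReal.rpow_one]
  have h2 := hb (absRpow f _ hSR) (absRpow g _ hP2)
  rw [eLpNorm_absRpow, eLpNorm_absRpow, mul_ofReal_toReal_div hr0 hrt hst,
    two_mul_ofReal_toReal_div_two hpt] at h2
  refine (eLpNorm_le_of_enorm_le_const_geom_mean (c := eLpNorm f s μ ^ s.toReal)
    (continuous_conv μ _ _).measurable.aemeasurable
    hp0 hpt hθ1 hp fun x => ?_).trans
    (mul_le_mul' le_rfl (ENNReal.rpow_le_rpow h2 hθ0) |>.trans_eq ?_)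
  · rw [enorm_conv_absRpow, ← h1]
    simpa using enorm_conv_le_geom_mean μ f g (b₀ := 0) hS.le le_rfl hSR.le hP2.le hθ0 hθ1 hs
      (by linarith) x
  · rw [ENNReal.mul_rpow_of_nonneg _ _ hθ0, ENNReal.mul_rpow_of_nonneg _ _ hθ0,
      ← ENNReal.rpow_mul, ← ENNReal.rpow_mul, ← ENNReal.rpow_mul]
    calc _ = C ^ θ * (eLpNorm f s μ ^ (s.toReal * (1 - θ)) *
            eLpNorm f s μ ^ (s.toReal / r.toReal * θ)) *
          eLpNorm g p μ ^ (p.toReal / 2 * θ) := by ring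
      _ = _ := by
        rw [← ENNReal.rpow_add_of_nonneg _ _ (by positivity) (by positivity), hs,
          show p.toReal / 2 * θ = 1 by linarith, ENNReal.rpow_one, ENNReal.rpow_one]

/-! ### Choice of exponents. -/

/-- The bounds on `L^q` and `L^p`, `1/p + 1/q = 1`, of convolution by `L^s` functions on a
Kunze-Stein group. -/
theorem IsKunzeStein.convBound (hG : IsKunzeStein μ) {q p s : ℝ≥0∞} (hpt : p ≠ ∞) (hq1 : 1 < q)
    (hq2 : q ≤ 2) (hpq : 1 / p + 1 / q = 1) (hs1 : 1 ≤ s) (hsq : s < q) :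
    ConvBound μ s q ∧ ConvBound μ s p := by
  have hqt : q ≠ ∞ := ne_top_of_le_ne_top ENNReal.ofNat_ne_top hq2
  have hst : s ≠ ∞ := hsq.ne_top
  have hq0 : q ≠ 0 := (zero_lt_one.trans hq1).ne'
  have hs0 : s ≠ 0 := (zero_lt_one.trans_le hs1).ne'
  have hp0 : p ≠ 0 := by
    rintro rfl
    simp at hpq
  have hP : 0 < p.toReal := ENNReal.toReal_pos hp0 hpt
  have hQ2 : q.toReal ≤ 2 := by simpa using ENNReal.toReal_mono ENNReal.ofNat_ne_top hq2
  have hQ1 : 1 < q.toReal := by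
    simpa using (ENNReal.toReal_lt_toReal ENNReal.one_ne_top hqt).2 hq1
  have hS1 : 1 ≤ s.toReal := by simpa using ENNReal.toReal_mono hst hs1
  have hSQ : s.toReal < q.toReal := (ENNReal.toReal_lt_toReal hst hqt).2 hsq
  have hPQ : 1 / p.toReal + 1 / q.toReal = 1 := by
    have := congrArg ENNReal.toReal hpq
    rwa [ENNReal.toReal_add (by simp [hp0]) (by simp [hq0]), ENNReal.toReal_div,
      ENNReal.toReal_div, ENNReal.toReal_one] at this
  have hPinv : 1 / p.toReal = 1 - 1 / q.toReal := by linarith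
  have hSinv : 1 / s.toReal ≤ 1 := by rw [div_le_one] <;> linarith
  have hSQinv : 1 / q.toReal < 1 / s.toReal := one_div_lt_one_div_of_lt (by linarith) hSQ
  have hP2 : 1 / p.toReal ≤ 1 / 2 := by
    have : 1 / 2 ≤ 1 / q.toReal := one_div_le_one_div_of_le (by linarith) hQ2
    linarith
  -- `κ = 1/r` is the solution of `1/s = (1 - θ) + θ/r` with `θ = 2/p`.
  set κ : ℝ := 1 - p.toReal / 2 * (1 - 1 / s.toReal) with hκ
  have hκ1 : κ ≤ 1 := by
    have : 0 ≤ p.toReal / 2 * (1 - 1 / s.toReal) := mul_nonneg (by positivity) (by linarith)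
    linarith
  -- This is `r < 2`: from `s < q`, `1 - 1/s < 1 - 1/q = 1/p`.
  have hκ2 : 1 / 2 < κ := by
    have : p.toReal / 2 * (1 - 1 / s.toReal) < p.toReal / 2 * (1 / p.toReal) :=
      mul_lt_mul_of_pos_left (by linarith) (by positivity)
    rw [div_mul_div_cancel₀' hP.ne'] at this
    linarith
  have hκ0 : 0 < κ := by linarith
  have hr1 : 1 ≤ ENNReal.ofReal (1 / κ) := by
    rw [ENNReal.one_le_ofReal, le_div_iff₀ hκ0]
    linarith
  have hr2 : ENNReal.ofReal (1 / κ) < 2 := by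
    rw [ENNReal.ofReal_lt_ofNat, div_lt_iff₀ hκ0]
    linarith
  have : Fact (1 ≤ ENNReal.ofReal (1 / κ)) := ⟨hr1⟩
  have hb : ConvBound μ (ENNReal.ofReal (1 / κ)) 2 := (hG _ hr2).convBound
  have hr0 : ENNReal.ofReal (1 / κ) ≠ 0 := (zero_lt_one.trans_le hr1).ne'
  have hθ0 : 0 ≤ 2 / p.toReal := by positivity
  have hθ1 : 2 / p.toReal ≤ 1 := by
    have : 2 / p.toReal = 2 * (1 / p.toReal) := by ring
    linarith
  have hs : s.toReal * (1 - 2 / p.toReal) +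
      s.toReal / (ENNReal.ofReal (1 / κ)).toReal * (2 / p.toReal) = 1 := by
    rw [ENNReal.toReal_ofReal (by positivity), div_div_eq_mul_div, div_one, hκ]
    field_simp
    ring
  refine ⟨hb.interpolate_one μ hr0 ENNReal.ofReal_ne_top hs0 hst hq0 hqt hθ0 hθ1 hs ?_,
    hb.interpolate_top μ hr0 ENNReal.ofReal_ne_top hs0 hst hp0 hpt hθ0 hθ1 hs
      (mul_div_cancel₀ _ hP.ne')⟩
  have : 2 / p.toReal / 2 = 1 / p.toReal := by ring
  rw [this, hPinv, sub_sub_cancel, mul_one_div_cancel (by linarith)]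

end Regular

end KunzeStein

end

theorem propositionP {G : Type*} [Group G] [TopologicalSpace G] [IsTopologicalGroup G]
    [LocallyCompactSpace G] [T2Space G] [MeasurableSpace G] [BorelSpace G]
    (μ : Measure G) [μ.IsHaarMeasure] [μ.Regular] (hG : KunzeStein.IsKunzeStein μ)
    (q p : ℝ≥0∞) [Fact (1 ≤ q)] [Fact (q ≠ ∞)] [Fact (1 ≤ p)] [Fact (p ≠ ∞)]
    (hq1 : 1 < q) (hq2 : q ≤ 2) (hpq : 1 / p + 1 / q = 1)
    (q' : ℝ≥0∞) [Fact (1 ≤ q')] (hq' : q' < q) :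
    KunzeStein.ConvExtends μ q' q ∧
    KunzeStein.ConvExtends μ q' p ∧
    ∃ Φ : Lp ℂ q' μ →L[ℂ] KunzeStein.PFStar μ p q,
      ∀ f : C_c(G, ℂ), Φ (KunzeStein.ccToLp μ q' f) =
        KunzeStein.toPFStar μ p q (KunzeStein.ccToLp μ 1 f) := by
  obtain ⟨h, h'⟩ := hG.convBound μ Fact.out hq1 hq2 hpq Fact.out hq'
  exact ⟨h.convExtends μ hq'.ne_top, h'.convExtends μ hq'.ne_top,
    h'.exists_extension_PFStar μ hq'.ne_top h⟩
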